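/- Let $p$ be an odd prime, $F$ a field of characteristic $p$, and $L=\bigoplus_{i\ge 1}L_i$ an infinite-dimensional graded Lie algebra of maximal class over $F$: that is, $\dim L_1=2$, $\dim L_i\le 1$ for $i\ge 2$, and $[L_i,L_1]=L_{i+1}$ for all $i\ge 1$. For $i\ge 2$ let $C_i=\{a\in L_1 : [L_i,a]=0\}$ be the two-step centralizers of $L$. Let $n_1<n_2<\cdots$ be the indices $n\ge 2$ with $C_n\ne C_2$; the constituents of $L$ are the segments $C_2,\dots,C_{n_1}$ and $C_{n_j+1},\dots,C_{n_{j+1}}$ for $j\ge1$, and the sequence of constituent lengths is $n_1,\ n_2-n_1,\ n_3-n_2,\dots$ (so the first constituent has, by convention, length $n_1$). Let $q=p^h$ and $r=p^k$ with $k\ge 1$, and let $0\le\beta<h$. Suppose that the sequence of constituent lengths of $L$ begins with the $r$ terms $$2q,\ \underbrace{q,\dots,q}_{r-2},\ 2q-p^\beta ,$$ and that the corresponding initial segment $C_2,C_3,\dots,C_{n_r}$ of the sequence of two-step centralizers involves only the first two two-step centralizers in order of occurrence, i.e. $C_i\in\{C_2,C_{2q}\}$ for $2\le i\le n_r$. Then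 $L$ has exactly two distinct two-step centralizers (the set $\{C_i : i\ge 2\}$ has two elements), $L$ has infinitely many constituents, and its whole sequence of constituent lengths is an infinite concatenation of blocks, each of which is one of the two patterns $$2q,\ \underbrace{q,\dots,q}_{r-2}\qquad\text{or}\qquad 2q-p^\beta,\ \underbrace{q,\dots,q}_{r-2}.$$ -/

import Mathlib

namespace MaxClass

variable {F L : Type*} [Field F] [LieRing L] [LieAlgebra F L]

/-- The family `𝒜` of subspaces makes the Lie algebra `L` over the field `F` a graded algebra of
maximal class: `L = ⨁_{i ≥ 1} 𝒜 i`, with `𝒜 1` of dimension `2`, every `𝒜 i` with `i ≥ 2` of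
dimension at most `1`, and `[𝒜 i, 𝒜 1] = 𝒜 (i + 1)` for every `i ≥ 1`. -/
structure IsMaximalClass (𝒜 : ℕ → Submodule F L) : Prop where
  isInternal : DirectSum.IsInternal 𝒜
  zero_eq_bot : 𝒜 0 = ⊥
  lie_mem : ∀ i j : ℕ, ∀ a ∈ 𝒜 i, ∀ b ∈ 𝒜 j, ⁅a, b⁆ ∈ 𝒜 (i + j)
  rank_one : Module.rank F (𝒜 1) = 2
  rank_le_one : ∀ i : ℕ, 2 ≤ i → Module.rank F (𝒜 i) ≤ 1
  span_lie : ∀ i : ℕ, 1 ≤ i →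
    Submodule.span F {c : L | ∃ a ∈ 𝒜 i, ∃ b ∈ 𝒜 1, ⁅a, b⁆ = c} = 𝒜 (i + 1)

/-- The two-step centralizer `C_i = C_{L_1}(L_i)`; it is meant for `i ≥ 2`. -/
def twoStepCentralizer (𝒜 : ℕ → Submodule F L) (i : ℕ) : Submodule F L where
  carrier := {a | a ∈ 𝒜 1 ∧ ∀ b ∈ 𝒜 i, ⁅b, a⁆ = 0}
  zero_mem' := ⟨Submodule.zero_mem _, fun b _ => lie_zero b⟩
  add_mem' := fun {a a'} ha ha' =>
    ⟨Submodule.add_mem _ ha.1 ha'.1, fun b hb => by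
      rw [lie_add, ha.2 b hb, ha'.2 b hb, add_zero]⟩
  smul_mem' := fun t a ha =>
    ⟨Submodule.smul_mem _ t ha.1, fun b hb => by rw [lie_smul, ha.2 b hb, smul_zero]⟩

/-- A constituent ends in weight `n` when `C_n` differs from the first two-step centralizer
`C_2`. -/
def IsConstituentEnd (𝒜 : ℕ → Submodule F L) (n : ℕ) : Prop :=
  2 ≤ n ∧ twoStepCentralizer 𝒜 n ≠ twoStepCentralizer 𝒜 2

/-- The weight in which the `j`-th constituent ends (counting from `j = 0`); the value is `0` if
there are at most `j` constituents. -/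
noncomputable def constituentEnd (𝒜 : ℕ → Submodule F L) (j : ℕ) : ℕ :=
  Nat.nth (IsConstituentEnd 𝒜) j

/-- The sequence of constituent lengths, counting from `0`. The first constituent
`C_2, …, C_n` has length `n` by convention; a later one `C_{i+1}, …, C_{i+m}` has length `m`.
The value is `0` beyond the last constituent (if there is one), and is positive for every actual
constituent. -/
noncomputable def constituentLength (𝒜 : ℕ → Submodule F L) : ℕ → ℕ
  | 0 => constituentEnd 𝒜 0
  | j + 1 => constituentEnd 𝒜 (j + 1) - constituentEnd 𝒜 j

/-- The first `N` terms of a sequence. -/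
def initialSegment (ℓ : ℕ → ℕ) (N : ℕ) : List ℕ := (List.range N).map ℓ

/-- The infinite sequence `ℓ` is an infinite concatenation `w 0, w 1, w 2, …` of nonempty finite
words from the set `S`. -/
def IsConcatenationOf (S : Set (List ℕ)) (ℓ : ℕ → ℕ) : Prop :=
  ∃ w : ℕ → List ℕ, (∀ n, w n ∈ S ∧ w n ≠ []) ∧
    ∀ n, initialSegment ℓ ((List.range n).flatMap w).length = (List.range n).flatMap w

end MaxClass

/-! The algebra enters only through a scalar sequence. Take y in C_2 and x in C_{2q}. Over F(X) the
element z = x + Xy centralizes no component, so v_1 = Xy, v_{i+1} = [v_i, z] are all nonzero, and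
[v_i, Xy] = f_i v_{i+1} defines f. For i ≥ 2, f_i is 0 or 1 exactly when C_i is C_2 or C_{2q}; any
other value marks a third centralizer. Moreover [v_j, v_{k+1}] = ((1 - shift)^k f)_j v_{j+k+1}, and
the Jacobi identity becomes the quadratic relation `IsCentralizerSequence.rel`.

In characteristic p, (1 - shift)^(p^n) = 1 - shift^(p^n), while (1 - shift)^(p^n - 1) sums over a
window of length p^n. Relations with k < 2q then force every later constituent length to be 2q or 2q
- p^g with g ≤ h (`exists_gap`, `gap_eq`); in particular the constituents never run out.

Put w = rq, a power of p, and e = p^β. The given initial segment says that f_w = 1 and that the next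
nonzero value is a 1 at w + 2q - e. Relations with k = w + s - 1 therefore compare f after j with f
after j + w. A block of r - 1 constituents has total length w or w - e, so each constituent can be
compared with the one r - 1 places earlier: length q recurs as q, and a long one is followed by one
of length 2q or 2q - e. `eq_one_of_long_gap` keeps the values equal to 1 at long constituents, which
excludes a third centralizer. `IsBlockSequence.lengths` runs this induction. -/

namespace MaxClass

/-! ### Iterated differences in characteristic p -/

open Finset

variable {K : Type*} [Field K]

/-- The left shift on sequences. -/
def shift (K : Type*) [Field K] : Module.End K (ℕ → K) :=
  LinearMap.funLeft K K (· + 1)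

theorem shift_pow_apply (n : ℕ) (f : ℕ → K) (j : ℕ) : (shift K ^ n) f j = f (j + n) := by
  induction n generalizing j with
  | zero => simp
  | succ n ih =>
    rw [pow_succ', Module.End.mul_apply]
    change (shift K ^ n) f (j + 1) = _
    rw [ih, add_right_comm, add_assoc]

/-- The `k`-th iterated backward difference `((1 - shift) ^ k) f`. -/
def diffIter (f : ℕ → K) (k : ℕ) : ℕ → K := ((1 - shift K) ^ k) f

@[simp] theorem diffIter_zero (f : ℕ → K) : diffIter f 0 = f := by simp [diffIter]

theorem diffIter_succ (f : ℕ → K) (k j : ℕ) :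
    diffIter f (k + 1) j = diffIter f k j - diffIter f k (j + 1) := by
  rw [diffIter, pow_succ', Module.End.mul_apply]
  rfl

theorem diffIter_add (f : ℕ → K) (k l : ℕ) : diffIter f (k + l) = diffIter (diffIter f k) l := by
  rw [diffIter, diffIter, diffIter, add_comm, pow_add, Module.End.mul_apply]

theorem diffIter_eq_sum (f : ℕ → K) (k j : ℕ) :
    diffIter f k j = ∑ l ∈ range (k + 1), (-1) ^ l * (k.choose l : K) * f (j + l) := by
  have h : (1 - Polynomial.X : Polynomial K) ^ k
      = ∑ l ∈ range (k + 1), ((-1) ^ l * (k.choose l : K)) • Polynomial.X ^ l := by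
    rw [sub_eq_neg_add, add_pow]
    refine sum_congr rfl fun l _ => ?_
    rw [neg_pow, one_pow, mul_one, Polynomial.smul_eq_C_mul]
    simp only [map_mul, map_pow, map_neg, map_one, map_natCast]
    ring
  have h2 := congrArg (Polynomial.aeval (shift K)) h
  simp only [map_pow, map_sub, map_one, map_sum, map_smul, Polynomial.aeval_X] at h2
  rw [diffIter, h2, LinearMap.sum_apply, Finset.sum_apply]
  refine sum_congr rfl fun l _ => ?_
  rw [LinearMap.smul_apply, Pi.smul_apply, shift_pow_apply, smul_eq_mul]

theorem diffIter_eq_zero {f : ℕ → K} {k j : ℕ} (h : ∀ l ≤ k, f (j + l) = 0) :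
    diffIter f k j = 0 := by
  rw [diffIter_eq_sum]
  refine sum_eq_zero fun l hl => ?_
  rw [h l (by simpa [Nat.lt_succ_iff] using hl), mul_zero]

theorem diffIter_eq_single {f : ℕ → K} {k j : ℕ} (a : ℕ) (ha : a ≤ k)
    (h : ∀ l ≤ k, l ≠ a → f (j + l) = 0) :
    diffIter f k j = (-1) ^ a * (k.choose a : K) * f (j + a) := by
  rw [diffIter_eq_sum]
  refine sum_eq_single_of_mem a (by simpa [Nat.lt_succ_iff] using ha) fun l hl hla => ?_
  rw [h l (by simpa [Nat.lt_succ_iff] using hl) hla, mul_zero]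

section CharP

variable (p : ℕ) [Fact p.Prime] [CharP K p]

/-- Frobenius applied to 1 - X, evaluated at the shift. -/
theorem diffIter_prime_pow (f : ℕ → K) (n j : ℕ) :
    diffIter f (p ^ n) j = f j - f (j + p ^ n) := by
  have h : (1 - Polynomial.X : Polynomial K) ^ p ^ n = 1 - Polynomial.X ^ p ^ n := by
    rw [sub_pow_char_pow, one_pow]
  have h2 := congrArg (Polynomial.aeval (shift K)) h
  simp only [map_pow, map_sub, map_one, Polynomial.aeval_X] at h2
  rw [diffIter, h2, LinearMap.sub_apply, Pi.sub_apply, shift_pow_apply, Module.End.one_apply]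

theorem diffIter_prime_pow_sub_one (f : ℕ → K) (n j : ℕ) :
    diffIter f (p ^ n - 1) j = ∑ l ∈ range (p ^ n), f (j + l) := by
  have hpos : 0 < p ^ n := pow_pos (Fact.out : p.Prime).pos n
  have h : (1 - Polynomial.X : Polynomial K) ^ (p ^ n - 1)
      = ∑ l ∈ range (p ^ n), Polynomial.X ^ l := by
    have h0 : (1 - Polynomial.X : Polynomial K) ≠ 0 := by
      intro h
      have := congrArg (Polynomial.eval 0) h
      simp at this
    apply mul_left_cancel₀ h0
    rw [mul_neg_geom_sum, ← pow_succ', Nat.sub_add_cancel hpos, sub_pow_char_pow, one_pow]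
  have h2 := congrArg (Polynomial.aeval (shift K)) h
  simp only [map_pow, map_sub, map_one, map_sum, Polynomial.aeval_X] at h2
  rw [diffIter, h2, LinearMap.sum_apply, Finset.sum_apply]
  exact sum_congr rfl fun l _ => shift_pow_apply l f j

theorem diffIter_prime_pow_add (f : ℕ → K) (n k : ℕ) :
    diffIter f (p ^ n + k) = diffIter (fun j => f j - f (j + p ^ n)) k := by
  rw [diffIter_add]
  congr 1
  funext j
  exact diffIter_prime_pow p f n j

/-- Lucas's theorem: the digits of p^v below position v are zero and contribute factors 1. -/
theorem cast_choose_prime_pow (n v : ℕ) : ((n.choose (p ^ v) : ℕ) : K) = ((n / p ^ v : ℕ) : K) := by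
  have hp : p.Prime := Fact.out
  rw [CharP.cast_eq_iff_mod_eq K p]
  have h := Choose.choose_modEq_choose_mul_prod_range_choose (p := p) (n := n) (k := p ^ v) v
  have h1 : ∏ i ∈ range v, (n / p ^ i % p).choose (p ^ v / p ^ i % p) = 1 := by
    refine prod_eq_one fun i hi => ?_
    have hi : i < v := by simpa using hi
    rw [Nat.pow_div hi.le hp.pos, Nat.mod_eq_zero_of_dvd (dvd_pow_self p (by omega)),
      Nat.choose_zero_right]
  rw [Nat.div_self (pow_pos hp.pos v), Nat.choose_one_right] at h
  rw [h1, Nat.cast_one, mul_one] at h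
  exact Int.natCast_modEq_iff.mp h

theorem cast_choose_eq_zero {n k b : ℕ} (hn : p ^ b ∣ n) (hk : ¬ p ^ b ∣ k) :
    ((n.choose k : ℕ) : K) = 0 := by
  have hp : p.Prime := Fact.out
  rw [CharP.cast_eq_zero_iff K p]
  by_contra h
  have h1 := Nat.Prime.emultiplicity_le_emultiplicity_choose_add hp n k
  rw [emultiplicity_eq_zero.mpr h, zero_add] at h1
  exact hk (pow_dvd_of_le_emultiplicity ((le_emultiplicity_of_pow_dvd hn).trans h1))

end CharP

end MaxClass

/-! ### Possible constituent lengths -/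

namespace MaxClass

open Finset

variable {K : Type*} [Field K]

/-- The relations satisfied by the coordinates of the two-step centralizers of an
infinite-dimensional algebra of maximal class with first constituent of length `2 q`. -/
structure IsCentralizerSequence (q : ℕ) (f : ℕ → K) : Prop where
  rel : ∀ k j, 1 ≤ j →
    diffIter f k j * (f (k + 1 + j) - f (k + 1)) = diffIter f k (j + 1) * (f j - f (k + 1))
  eq_zero : ∀ i, 1 ≤ i → i < 2 * q → f i = 0
  eq_one : f (2 * q) = 1

/-- The first nonzero term of `f` after position `j` is in position `j + m`. -/
structure IsGap (f : ℕ → K) (j m : ℕ) : Prop where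
  pos : 0 < m
  ne_zero : f (j + m) ≠ 0
  eq_zero : ∀ s, 0 < s → s < m → f (j + s) = 0

theorem IsGap.eq {f : ℕ → K} {j m m' : ℕ} (h : IsGap f j m) (h' : IsGap f j m') : m = m' := by
  rcases lt_trichotomy m m' with hlt | rfl | hlt
  · exact absurd (h'.eq_zero m h.pos hlt) h.ne_zero
  · rfl
  · exact absurd (h.eq_zero m' h'.pos hlt) h'.ne_zero

namespace IsCentralizerSequence

section

variable {q : ℕ} {f : ℕ → K} (S : IsCentralizerSequence q f)
include S

/-- If f vanished on the 2q positions after j, the relation with k + 1 = 2q, where f is 1, would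
read -f j = 0. -/
theorem exists_gap (hq : 0 < q) {j : ℕ} (hj : 1 ≤ j) (hf : f j ≠ 0) : ∃ m ≤ 2 * q, IsGap f j m := by
  classical
  have hex : ∃ m, 0 < m ∧ m ≤ 2 * q ∧ f (j + m) ≠ 0 := by
    by_contra! hno
    have h := S.rel (2 * q - 1) j hj
    rw [Nat.sub_add_cancel (by omega), S.eq_one,
      diffIter_eq_zero (j := j + 1) (fun l hl => by
        rw [add_assoc]; exact hno (1 + l) (by omega) (by omega)),
      diffIter_eq_single (j := j) 0 (Nat.zero_le _) (fun l hl h0 => hno l (by omega) (by omega)),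
      add_comm (2 * q) j, hno (2 * q) (by omega) le_rfl] at h
    simp [hf] at h
  obtain ⟨h1, h2, h3⟩ := Nat.find_spec hex
  refine ⟨Nat.find hex, h2, h1, h3, fun s hs0 hs => ?_⟩
  by_contra hne
  exact Nat.find_min hex hs ⟨hs0, by omega, hne⟩

end

section

variable {p h q : ℕ} [Fact p.Prime] [CharP K p] {f : ℕ → K} (hq : q = p ^ h)
  (S : IsCentralizerSequence q f)
include hq S

omit S in
theorem length_pos : 0 < q := hq ▸ pow_pos (Fact.out : p.Prime).pos h

/-- A window of length q holds at most one nonzero value, by sliding it along: when the window at j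
loses a zero and still contains a nonzero value, its sum is that value, and the relation with k + 1
= q makes the entering value f (j + q) zero. -/
theorem add_le_of_ne_zero {a b : ℕ} (ha : 1 ≤ a) (hab : a < b) (hfa : f a ≠ 0) (hfb : f b ≠ 0) :
    a + q ≤ b := by
  have hq0 := length_pos (p := p) hq
  have key : ∀ j, 1 ≤ j → ∀ a b, j ≤ a → a < b → b < j + q → f a ≠ 0 → f b = 0 := by
    intro j hj
    induction j, hj using Nat.le_induction with
    | base => exact fun a b ha hab hb _ => S.eq_zero b (by omega) (by omega)
    | succ j hj ih =>
      intro a b ha hab hb hfa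
      by_cases hbj : b < j + q
      · exact ih a b (by omega) hab hbj hfa
      have hb' : b = q + j := by omega
      have hfj : f j = 0 := by
        by_contra hne
        exact hfa (ih j a le_rfl (by omega) (by omega) hne)
      have hr := S.rel (q - 1) j hj
      rw [Nat.sub_add_cancel hq0, S.eq_zero q hq0 (by omega), hfj, sub_zero, sub_zero, mul_zero,
        ← hb'] at hr
      have hsum : diffIter f (q - 1) j = f a := by
        rw [hq, diffIter_prime_pow_sub_one p, ← hq]
        rw [sum_eq_single_of_mem (a - j) (mem_range.mpr (by omega))]
        · rw [Nat.add_sub_cancel' (by omega)]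
        · intro l hl hne
          have hl := mem_range.mp hl
          by_contra hfl
          rcases lt_or_gt_of_ne (show j + l ≠ a by omega) with hlt | hlt
          · exact hfa (ih _ a (by omega) hlt (by omega) hfl)
          · exact hfl (ih a _ (by omega) hlt (by omega) hfa)
      rw [hsum] at hr
      exact (mul_eq_zero.mp hr).resolve_left hfa
  by_contra hlt
  exact hfb (key a ha a b le_rfl hab (by omega) hfa)

theorem eq_zero_after {a s : ℕ} (ha : 1 ≤ a) (hfa : f a ≠ 0) (hs : 0 < s) (hsq : s < q) :
    f (a + s) = 0 := by
  by_contra hne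
  have := S.add_le_of_ne_zero hq ha (by omega) hfa hne
  omega

theorem le_gap {j m : ℕ} (hj : 1 ≤ j) (hf : f j ≠ 0) (hm : IsGap f j m) : q ≤ m := by
  have := S.add_le_of_ne_zero hq hj (by have := hm.pos; omega) hf hm.ne_zero
  omega

/-- Let p^v be the exact power of p dividing m. If m + p^v < 2q, the relation with k + 1 = m + p^v
leaves one term, whose binomial coefficient is m / p^v modulo p, hence nonzero. -/
theorem gap_eq {j m : ℕ} (hj : 1 ≤ j) (hf : f j ≠ 0) (hm : IsGap f j m) :
    m = 2 * q ∨ ∃ g ≤ h, m + p ^ g = 2 * q := by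
  have hp : p.Prime := Fact.out
  have hq0 := length_pos (p := p) hq
  have hmq := S.le_gap hq hj hf hm
  obtain ⟨m', hm', hgap⟩ := S.exists_gap hq0 hj hf
  obtain rfl := hm.eq hgap
  rcases eq_or_lt_of_le hm' with heq | hlt
  · exact Or.inl heq
  right
  obtain ⟨v, a, hpa, hva⟩ := Nat.exists_eq_pow_mul_and_not_dvd (n := m) (by omega) p hp.ne_one
  have hv0 : 0 < p ^ v := pow_pos hp.pos v
  have ha0 : 0 < a := by
    rcases Nat.eq_zero_or_pos a with rfl | h
    · simp at hpa
    · exact h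
  have hvm : p ^ v ≤ m := by rw [hva]; exact Nat.le_mul_of_pos_right _ ha0
  have hvh : v ≤ h := by
    by_contra hlt'
    have h1 : p ^ (h + 1) ≤ p ^ v := Nat.pow_le_pow_right hp.pos (by omega)
    have h2 : 2 * q ≤ p ^ (h + 1) := by
      rw [pow_succ, hq, mul_comm]
      exact Nat.mul_le_mul_left _ hp.two_le
    omega
  have hdvd : p ^ v ∣ 2 * q - m := by
    refine Nat.dvd_sub (Dvd.dvd.mul_left ?_ 2) ⟨a, hva⟩
    rw [hq]
    exact pow_dvd_pow p hvh
  have hle : p ^ v ≤ 2 * q - m := Nat.le_of_dvd (by omega) hdvd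
  refine ⟨v, hvh, ?_⟩
  by_contra hne
  have hvq : p ^ v ≤ q := by rw [hq]; exact Nat.pow_le_pow_right hp.pos hvh
  have hr := S.rel (m + p ^ v - 1) j hj
  rw [Nat.sub_add_cancel (by omega), S.eq_zero (m + p ^ v) (by omega) (by omega), sub_zero,
    sub_zero, show m + p ^ v + j = (j + m) + p ^ v by ring,
    S.eq_zero_after hq (by omega) hm.ne_zero hv0 (by omega), mul_zero] at hr
  have hz := (mul_eq_zero.mp hr.symm).resolve_right hf
  rw [diffIter_eq_single (j := j + 1) (m - 1) (by omega)] at hz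
  · rw [show j + 1 + (m - 1) = j + m by omega] at hz
    have hc : (((m + p ^ v - 1).choose (m - 1) : ℕ) : K) ≠ 0 := by
      rw [← Nat.choose_symm (by omega), show m + p ^ v - 1 - (m - 1) = p ^ v by omega,
        cast_choose_prime_pow p]
      rw [show m + p ^ v - 1 = p ^ v - 1 + p ^ v * a by omega, Nat.add_mul_div_left _ _ hv0,
        Nat.div_eq_of_lt (by omega), zero_add, Ne, CharP.cast_eq_zero_iff K p]
      exact hpa
    exact (mul_ne_zero (mul_ne_zero (pow_ne_zero _ (by simp)) hc) hm.ne_zero) hz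
  · intro l hl hne'
    rcases lt_or_gt_of_ne hne' with h1 | h1
    · rw [add_assoc]
      exact hm.eq_zero _ (by omega) (by omega)
    · rw [show j + 1 + l = (j + m) + (l + 1 - m) by omega]
      exact S.eq_zero_after hq (by omega) hm.ne_zero (by omega) (by omega)

end

end IsCentralizerSequence

end MaxClass

/-! ### Comparison of one block with the next -/

namespace MaxClass

open Finset

variable {K : Type*} [Field K]

/-- A centralizer sequence whose initial part describes the constituent lengths
`2 q, q, …, q, 2 q - e`, the last of the constituents of length `q` ending in position `w`. -/
structure IsBlockSequence (q w e : ℕ) (f : ℕ → K) : Prop extends IsCentralizerSequence q f where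
  block_end : f w = 1
  second_eq_zero : ∀ i, w < i → i + e < w + 2 * q → f i = 0
  second_eq_one : ∀ i, i + e = w + 2 * q → f i = 1

theorem three_mul_pow_le {p g h : ℕ} (hp : 3 ≤ p) (hgh : g < h) : 3 * p ^ g ≤ p ^ h := by
  calc 3 * p ^ g ≤ p ^ (g + 1) := by
        rw [pow_succ, mul_comm]; exact Nat.mul_le_mul_left _ hp
    _ ≤ p ^ h := Nat.pow_le_pow_right (by omega) hgh

namespace IsBlockSequence

variable {p h c β q w e : ℕ} [Fact p.Prime] [CharP K p] {f : ℕ → K}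

theorem diffIter_eq_zero_of_rel (S : IsBlockSequence q w e f) {s j : ℕ} (hs : 0 < s)
    (hse : s + e < 2 * q) (hj : 1 ≤ j) (hfj : f j ≠ 0)
    (h0 : diffIter f (w + s - 1) j * f (j + w + s) = 0) :
    diffIter f (w + (s - 1)) (j + 1) = 0 := by
  have hr := S.rel (w + s - 1) j hj
  rw [Nat.sub_add_cancel (by omega), S.second_eq_zero (w + s) (by omega) (by omega), sub_zero,
    sub_zero, show w + s + j = j + w + s by ring, h0] at hr
  rw [← Nat.add_sub_assoc hs]
  exact (mul_eq_zero.mp hr.symm).resolve_right hfj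

/-- Since w is a power of p, the difference of order w + s - 1 is the one of order s - 1 of f - f(·
+ w). By induction only its last term can survive, and the relation kills it. -/
theorem eq_of_eq_add (S : IsBlockSequence q w e f) (hw : w = p ^ c) {j : ℕ} (hj : 1 ≤ j)
    (hfj : f j ≠ 0) (hfw : f (j + w) = f j) {s : ℕ} (hs : s + e < 2 * q) :
    f (j + w + s) = f (j + s) := by
  induction s using Nat.strong_induction_on with
  | _ s ih =>
    rcases Nat.eq_zero_or_pos s with rfl | hs0
    · simpa using hfw
    have hz : ∀ l < s, f (j + l) - f (j + l + w) = 0 := fun l hl => by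
      rw [add_right_comm, ih l hl (by omega), sub_self]
    have h1 := S.diffIter_eq_zero_of_rel hs0 hs hj hfj (by
      rw [Nat.add_sub_assoc hs0, hw, diffIter_prime_pow_add p, ← hw,
        diffIter_eq_zero (fun l hl => hz l (by omega)), zero_mul])
    rw [hw, diffIter_prime_pow_add p, ← hw, diffIter_eq_single (s - 1) le_rfl] at h1
    · rw [Nat.choose_self, Nat.cast_one, mul_one, show j + 1 + (s - 1) = j + s by omega] at h1
      have h2 := (mul_eq_zero.mp h1).resolve_left (pow_ne_zero _ (by simp))
      rw [add_right_comm]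
      exact (sub_eq_zero.mp h2).symm
    · intro l hl hne
      rw [show j + 1 + l = j + (l + 1) by ring]
      exact hz (l + 1) (by omega)

/-- If `j` and `n` are ends of constituents with `n + e = j + w`, then the sums of `f` over the
windows of length `q` after `j` and after `n + e` agree. -/
theorem sum_window_eq (S : IsBlockSequence q w e f) (hw : w = p ^ c) (hq : q = p ^ h)
    (heq : e < q) {j n : ℕ} (hj : 1 ≤ j) (hfj : f j ≠ 0) (hn : n + e = j + w)
    (h0 : f (n + (e + q)) = 0) :
    ∑ l ∈ range q, f (j + 1 + l) = ∑ l ∈ range q, f (n + e + 1 + l) := by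
  -- The difference of order w + q - 1 is a window sum of length q of f - f(· + w).
  have h1 := S.diffIter_eq_zero_of_rel (s := q) (by omega) (by omega) hj hfj (by
    rw [← hn, add_assoc, h0, mul_zero])
  rw [hw, diffIter_prime_pow_add p, ← hw] at h1
  nth_rewrite 1 [hq] at h1
  rw [diffIter_prime_pow_sub_one p, ← hq, sum_sub_distrib, sub_eq_zero] at h1
  rw [h1]
  refine sum_congr rfl fun l _ => ?_
  rw [hn]
  ring_nf

/-- The window after j has sum 1, so the one after n + e cannot be empty. As p ≥ 3, a gap other than
q exceeds q + e and would leave it empty. -/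
theorem gap_of_gap_eq_add (S : IsBlockSequence q w e f) (hp : 3 ≤ p) (hw : w = p ^ c)
    (hq : q = p ^ h) (he : e = p ^ β) (hβ : β < h) {j n m : ℕ} (hj : 1 ≤ j) (hn1 : 1 ≤ n)
    (hfj : f j = 1) (hfq : f (j + q) = 1) (hn : n + e = j + w) (hfn : f n ≠ 0)
    (hm : IsGap f n m) : m = q ∧ f (n + m) = 1 := by
  have h3 : 3 * e ≤ q := by rw [he, hq]; exact three_mul_pow_le hp hβ
  have he0 : 0 < e := he ▸ pow_pos (by omega) β
  have S' := S.toIsCentralizerSequence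
  have hcases : m = q ∨ q + e < m := by
    rcases S'.gap_eq hq hn1 hfn hm with h1 | ⟨g, hg, h1⟩
    · omega
    · rcases eq_or_lt_of_le hg with rfl | hlt
      · omega
      · have := three_mul_pow_le hp hlt
        omega
  have h0 : f (n + (e + q)) = 0 := by
    rcases hcases with rfl | hlt
    · rw [show n + (e + m) = n + m + e by ring]
      exact S'.eq_zero_after hq (by omega) hm.ne_zero he0 (by omega)
    · exact hm.eq_zero _ (by omega) (by omega)
  have hsum := S.sum_window_eq hw hq (by omega) hj (by simp [hfj]) hn h0
  rw [sum_eq_single_of_mem (q - 1) (mem_range.mpr (by omega)) (fun l hl hne => by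
      have := mem_range.mp hl
      rw [add_assoc]
      exact S'.eq_zero_after hq hj (by simp [hfj]) (by omega) (by omega)),
    show j + 1 + (q - 1) = j + q by omega, hfq] at hsum
  rcases hcases with rfl | hlt
  · refine ⟨rfl, ?_⟩
    rw [sum_eq_single_of_mem (m - e - 1) (mem_range.mpr (by omega)),
      show n + e + 1 + (m - e - 1) = n + m by omega] at hsum
    · exact hsum.symm
    · intro l hl hne
      have := mem_range.mp hl
      rcases lt_or_gt_of_ne hne with h1 | h1
      · rw [show n + e + 1 + l = n + (e + 1 + l) by ring]
        exact hm.eq_zero _ (by omega) (by omega)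
      · rw [show n + e + 1 + l = n + m + (e + 1 + l - m) by omega]
        exact S'.eq_zero_after hq (by omega) hm.ne_zero (by omega) (by omega)
  · rw [sum_eq_zero (fun l hl => by
      have := mem_range.mp hl
      rw [show n + e + 1 + l = n + (e + 1 + l) by ring]
      exact hm.eq_zero _ (by omega) (by omega))] at hsum
    exact absurd hsum one_ne_zero

/-- The relation with k + 1 = w says that the sum of f over the w positions from j on, times f (j +
w) - 1, is zero. The r - 1 ends with value 1 contribute -1. The remaining end n + m is either j + w
itself or inside the window, and both cases give the value 1. -/
theorem eq_one_of_long_gap (S : IsBlockSequence q w e f) {r : ℕ} (hr2 : 2 ≤ r)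
    (hr : (r : K) = 0) (hw : w = p ^ c) (hwr : w = r * q) (hq : q = p ^ h) {j n m : ℕ}
    (hj : 1 ≤ j) (hends : ∀ a, a + 2 ≤ r → f (j + a * q) = 1) (hn : n = j + (r - 2) * q)
    (hm : IsGap f n m) (hqm : q < m) : f (n + m) = 1 := by
  have hq0 : 0 < q := IsCentralizerSequence.length_pos (p := p) hq
  have S' := S.toIsCentralizerSequence
  have hfj : f j = 1 := by simpa using hends 0 (by omega)
  have hfn : f n = 1 := by rw [hn]; exact hends _ (by omega)
  have hn2 : n + 2 * q = j + w := by
    obtain ⟨t, rfl⟩ := Nat.exists_eq_add_of_le hr2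
    rw [hn, hwr, Nat.add_sub_cancel_left]
    ring
  have hw0 : 0 < w := by rw [hwr]; positivity
  have hr' := S'.rel (w - 1) j hj
  rw [Nat.sub_add_cancel hw0, S.block_end, hfj, sub_self, mul_zero, add_comm w j, hw,
    diffIter_prime_pow_sub_one p, ← hw] at hr'
  have hinner : ∀ t, t + 1 ≤ r → ∑ l ∈ range (t * q), f (j + l) = t := by
    intro t
    induction t with
    | zero => simp
    | succ t ih =>
      intro ht
      rw [Nat.succ_mul, sum_range_add, ih (by omega), sum_eq_single_of_mem 0 (mem_range.mpr hq0)]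
      · rw [add_zero, hends t (by omega), Nat.cast_succ]
      · intro l hl hne
        rw [← add_assoc]
        exact S'.eq_zero_after hq (by omega) (by simp [hends t (by omega)]) (by omega)
          (mem_range.mp hl)
  have hfull : ∑ l ∈ range w, f (j + l) = -1 + ∑ l ∈ range q, f (n + q + l) := by
    obtain ⟨t, rfl⟩ := Nat.exists_eq_add_of_le hr2
    have ht : ((t + 1 : ℕ) : K) = -1 := by
      push_cast at hr ⊢
      linear_combination hr
    rw [show w = (t + 1) * q + q by rw [hwr]; ring, sum_range_add, hinner (t + 1) (by omega), ht]
    congr 1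
    refine sum_congr rfl fun l _ => ?_
    rw [hn, Nat.add_sub_cancel_left]
    ring_nf
  obtain ⟨m', hm', hgap⟩ := S'.exists_gap hq0 (j := n) (by omega) (by simp [hfn])
  obtain rfl := hm.eq hgap
  rw [hfull] at hr'
  rcases eq_or_lt_of_le hm' with heq | hlt
  · rw [sum_eq_zero (fun l hl => by
      have := mem_range.mp hl
      rw [add_assoc]
      exact hm.eq_zero _ (by omega) (by omega)), ← hn2, ← heq] at hr'
    linear_combination -hr'
  · rw [sum_eq_single_of_mem (m - q) (mem_range.mpr (by omega)) (fun l hl hne => by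
      have := mem_range.mp hl
      rcases lt_or_gt_of_ne hne with h1 | h1
      · rw [add_assoc]
        exact hm.eq_zero _ (by omega) (by omega)
      · rw [show n + q + l = n + m + (q + l - m) by omega]
        exact S'.eq_zero_after hq (by omega) hm.ne_zero (by omega) (by omega)),
      show n + q + (m - q) = n + m by omega, ← hn2,
      show n + 2 * q = n + m + (2 * q - m) by omega,
      S'.eq_zero_after hq (by omega) hm.ne_zero (by omega) (by omega)] at hr'
    linear_combination -hr'

/-- After a block of length `w`, the next constituent has length `2 q` or `2 q - e`. -/
theorem long_gap_after_long (S : IsBlockSequence q w e f) (hp : 3 ≤ p) (hw : w = p ^ c)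
    (hq : q = p ^ h) (he : e = p ^ β) (hβ : β < h) {j n m : ℕ} (hj : 1 ≤ j)
    (hfj : f j = 1) (hn : n = j + w) (hfn : f n = 1) (hjm : IsGap f j (2 * q))
    (hm : IsGap f n m) (hone : q < m → f (n + m) = 1) :
    q < m ∧ (m = 2 * q ∨ m + e = 2 * q) := by
  have h3 : 3 * e ≤ q := by rw [he, hq]; exact three_mul_pow_le hp hβ
  have he0 : 0 < e := he ▸ pow_pos (by omega) β
  have S' := S.toIsCentralizerSequence
  have hlarge : 2 * q ≤ m + e := by
    by_contra hlt
    apply hm.ne_zero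
    rw [hn, S.eq_of_eq_add hw hj (by simp [hfj]) (by rw [← hn, hfn, hfj]) (by omega)]
    exact hjm.eq_zero m hm.pos (by omega)
  refine ⟨by omega, ?_⟩
  rcases S'.gap_eq hq (by omega) (by simp [hfn]) hm with h1 | ⟨g, -, h1⟩
  · exact Or.inl h1
  right
  by_contra hne
  have hg0 : 0 < p ^ g := pow_pos (by omega) g
  -- Here p^g < e. The index k + 1 is the end w + 2q - e, and the base point is shifted so that k +
  -- 1 + j becomes n + m: both values are 1 and the left side vanishes, while the right side keeps
  -- the single term f (n + m).
  have hr := S.rel (w + (2 * q - e - 1)) (j + (e - p ^ g)) (by omega)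
  rw [show w + (2 * q - e - 1) + 1 + (j + (e - p ^ g)) = n + m by omega,
    hone (by omega), S.second_eq_one (w + (2 * q - e - 1) + 1) (by omega), sub_self, mul_zero,
    hjm.eq_zero (e - p ^ g) (by omega) (by omega), hw, diffIter_prime_pow_add p, ← hw,
    diffIter_eq_single (2 * q - e - 1) le_rfl] at hr
  · rw [show j + (e - p ^ g) + 1 + (2 * q - e - 1) = j + m by omega,
      hjm.eq_zero m hm.pos (by omega), show j + m + w = n + m by omega, hone (by omega)] at hr
    rw [Nat.choose_self, Nat.cast_one, mul_one, zero_sub] at hr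
    exact mul_ne_zero (mul_ne_zero (pow_ne_zero _ (by simp)) (by simp)) (by simp) hr.symm
  · intro l hl hne'
    rw [show j + (e - p ^ g) + 1 + l = j + (e - p ^ g + 1 + l) by ring,
      hjm.eq_zero _ (by omega) (by omega), add_right_comm, ← hn,
      hm.eq_zero _ (by omega) (by omega), sub_self]

/-- After a block of length `w - e`, the next constituent has length `2 q` or `2 q - e`. -/
theorem long_gap_after_short (S : IsBlockSequence q w e f) (hp : 3 ≤ p) (hw : w = p ^ c)
    (hq : q = p ^ h) (he : e = p ^ β) (hβ : β < h) {j n m : ℕ} (hj : 1 ≤ j) (hn1 : 1 ≤ n)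
    (hfj : f j = 1) (hn : n + e = j + w) (hfn : f n = 1) (hjm : IsGap f j (2 * q - e))
    (hm : IsGap f n m) : q < m ∧ (m = 2 * q ∨ m + e = 2 * q) := by
  have h3 : 3 * e ≤ q := by rw [he, hq]; exact three_mul_pow_le hp hβ
  have he0 : 0 < e := he ▸ pow_pos (by omega) β
  have hpp : p.Prime := Fact.out
  have S' := S.toIsCentralizerSequence
  have hafter : ∀ s, 0 < s → s < q → f (n + m + s) = 0 := fun s h0 hs =>
    S'.eq_zero_after hq (by omega) hm.ne_zero h0 hs
  rcases S'.gap_eq hq hn1 (by simp [hfn]) hm with h1 | ⟨g, hg, h1⟩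
  · exact ⟨by omega, Or.inl h1⟩
  rcases eq_or_lt_of_le hg with rfl | hgh
  · exfalso
    obtain rfl : m = q := by omega
    have hsum := S.sum_window_eq hw hq (by omega) hj (by simp [hfj]) hn (by
      rw [show n + (e + m) = n + m + e by ring]
      exact hafter e he0 (by omega))
    rw [sum_eq_zero (fun l hl => by
        have := mem_range.mp hl
        rw [add_assoc]
        exact hjm.eq_zero _ (by omega) (by omega)),
      sum_eq_single_of_mem (m - e - 1) (mem_range.mpr (by omega)),
      show n + e + 1 + (m - e - 1) = n + m by omega] at hsum
    · exact hm.ne_zero hsum.symm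
    · intro l hl hne
      have := mem_range.mp hl
      rcases lt_or_gt_of_ne hne with h2 | h2
      · rw [show n + e + 1 + l = n + (e + 1 + l) by ring]
        exact hm.eq_zero _ (by omega) (by omega)
      · rw [show n + e + 1 + l = n + m + (e + 1 + l - m) by omega]
        exact hafter _ (by omega) (by omega)
  have hg3 : 3 * p ^ g ≤ q := hq ▸ three_mul_pow_le hp hgh
  have hg0 : 0 < p ^ g := pow_pos (by omega) g
  refine ⟨by omega, Or.inr ?_⟩
  -- Either condition makes N / e congruent to -1 modulo p.
  have hcast : ∀ N, N / e + 1 = 2 * p ^ (h - β) ∨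
      (∃ t, 0 < t ∧ N / e + 1 + p ^ t = 2 * p ^ (h - β)) →
      ((N.choose e : ℕ) : K) ≠ 0 := by
    intro N hN
    rw [he, cast_choose_prime_pow p, ← he]
    have hhb : ((p ^ (h - β) : ℕ) : K) = 0 := by
      rw [CharP.cast_eq_zero_iff K p]
      exact dvd_pow_self p (by omega)
    rcases hN with hN | ⟨t, ht, hN⟩
    · have h2 := congrArg (Nat.cast : ℕ → K) hN
      push_cast at h2 hhb
      rw [hhb, mul_zero] at h2
      rw [eq_neg_of_add_eq_zero_left h2]
      simp
    · have h2 := congrArg (Nat.cast : ℕ → K) hN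
      push_cast at h2 hhb
      rw [hhb, mul_zero, CharP.cast_eq_zero K p, zero_pow (by omega), add_zero] at h2
      rw [eq_neg_of_add_eq_zero_left h2]
      simp
  have hqe : q = e * p ^ (h - β) := by rw [hq, he, ← pow_add]; congr 1; omega
  rcases lt_trichotomy g β with hgb | rfl | hbg
  · exfalso
    have hge : 3 * p ^ g ≤ e := he ▸ three_mul_pow_le hp hgb
    have hr := S.rel (w + (2 * q - e - 1)) (j + (e - p ^ g)) (by omega)
    rw [show w + (2 * q - e - 1) + 1 + (j + (e - p ^ g)) = n + m + e by omega,
      hafter e he0 (by omega), S.second_eq_one (w + (2 * q - e - 1) + 1) (by omega),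
      hjm.eq_zero (e - p ^ g) (by omega) (by omega)] at hr
    -- Both bracketed factors of the relation equal -1, so two consecutive differences agree and the
    -- next order vanishes.
    have hr2 : diffIter f (w + (2 * q - e)) (j + (e - p ^ g)) = 0 := by
      rw [show w + (2 * q - e) = w + (2 * q - e - 1) + 1 by omega, diffIter_succ]
      linear_combination -hr
    rw [hw, diffIter_prime_pow_add p, ← hw, diffIter_eq_sum,
      sum_eq_single_of_mem (2 * q - 2 * e) (mem_range.mpr (by omega))] at hr2
    · rw [show j + (e - p ^ g) + (2 * q - 2 * e) = j + (2 * q - e - p ^ g) by omega,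
        hjm.eq_zero _ (by omega) (by omega),
        show j + (2 * q - e - p ^ g) + w = n + m by omega, zero_sub,
        ← Nat.choose_symm (by omega), show 2 * q - e - (2 * q - 2 * e) = e by omega] at hr2
      refine mul_ne_zero (mul_ne_zero (pow_ne_zero _ (by simp)) (hcast _ (Or.inl ?_)))
        (neg_ne_zero.mpr hm.ne_zero) hr2
      have hpos : 0 < p ^ (h - β) := pow_pos hpp.pos _
      rw [hqe, show 2 * (e * p ^ (h - β)) - e = e * (2 * p ^ (h - β) - 1) by
        rw [Nat.mul_sub, mul_one]; ring_nf, Nat.mul_div_cancel_left _ he0]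
      omega
    · intro l hl hne
      have hl := mem_range.mp hl
      -- This position meets the nonzero value at j + 2q - e, but its binomial coefficient vanishes:
      -- e divides 2q - e and not e - p^g.
      by_cases hle : l = 2 * q - 2 * e + p ^ g
      · rw [← Nat.choose_symm (by omega), cast_choose_eq_zero p (b := β), mul_zero, zero_mul]
        · rw [← he]
          exact Nat.dvd_sub (hqe ▸ Dvd.dvd.mul_left (Dvd.intro _ rfl) 2) dvd_rfl
        · rw [← he]
          intro hdvd
          have := Nat.le_of_dvd (by omega) hdvd
          omega
      · have hz1 : f (j + (e - p ^ g) + l) = 0 := by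
          rcases lt_or_gt_of_ne hle with h2 | h2
          · rw [add_assoc]
            exact hjm.eq_zero _ (by omega) (by omega)
          · rw [show j + (e - p ^ g) + l
              = j + (2 * q - e) + (l - (2 * q - 2 * e + p ^ g)) by omega]
            exact S'.eq_zero_after hq (by omega) hjm.ne_zero (by omega) (by omega)
        have hz2 : f (j + (e - p ^ g) + l + w) = 0 := by
          rcases lt_or_gt_of_ne hne with h2 | h2
          · rw [show j + (e - p ^ g) + l + w = n + (e + (e - p ^ g) + l) by omega]
            exact hm.eq_zero _ (by omega) (by omega)
          · rw [show j + (e - p ^ g) + l + w = n + m + (l - (2 * q - 2 * e)) by omega]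
            exact hafter _ (by omega) (by omega)
        rw [hz1, hz2, sub_self, mul_zero]
  · rw [he]; exact h1
  · exfalso
    have hbe : 3 * e ≤ p ^ g := he ▸ three_mul_pow_le hp hbg
    have hz := S.diffIter_eq_zero_of_rel (s := m) hm.pos (by omega) hj (by simp [hfj]) (by
      rw [show j + w + m = n + m + e by omega, hafter e he0 (by omega), mul_zero])
    rw [hw, diffIter_prime_pow_add p, ← hw, diffIter_eq_single (m - 1 - e) (by omega)] at hz
    · rw [show j + 1 + (m - 1 - e) = j + (m - e) by omega, hjm.eq_zero _ (by omega) (by omega),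
        show j + (m - e) + w = n + m by omega, zero_sub, Nat.choose_symm (by omega)] at hz
      refine mul_ne_zero (mul_ne_zero (pow_ne_zero _ (by simp))
        (hcast _ (Or.inr ⟨g - β, by omega, ?_⟩))) (neg_ne_zero.mpr hm.ne_zero) hz
      have hge : p ^ g = e * p ^ (g - β) := by rw [he, ← pow_add]; congr 1; omega
      have hgh' : p ^ (g - β) < p ^ (h - β) := Nat.pow_lt_pow_right (by omega) (by omega)
      obtain ⟨t, ht⟩ := Nat.exists_eq_add_of_lt (show p ^ (g - β) < 2 * p ^ (h - β) by omega)
      have hmt : m - 1 = e - 1 + e * t := by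
        have : m = e * t + e := by
          have h4 : 2 * q = e * (2 * p ^ (h - β)) := by rw [hqe]; ring
          rw [ht] at h4
          rw [h4, hge] at h1
          nlinarith
        omega
      rw [hmt, Nat.add_mul_div_left _ _ he0, Nat.div_eq_of_lt (by omega)]
      omega
    · intro l hl hne
      rw [show j + 1 + l = j + (1 + l) by ring, hjm.eq_zero _ (by omega) (by omega)]
      rcases lt_or_gt_of_ne hne with h2 | h2
      · rw [show j + (1 + l) + w = n + (e + 1 + l) by omega, hm.eq_zero _ (by omega) (by omega),
          sub_self]
      · rw [show j + (1 + l) + w = n + m + (e + 1 + l - m) by omega,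
          hafter _ (by omega) (by omega), sub_self]

end IsBlockSequence

end MaxClass

/-! ### Induction over the constituents -/

namespace MaxClass

open Finset

variable {K : Type*} [Field K]

theorem IsBlockSequence.lengths {p h c β q w e r : ℕ} [Fact p.Prime] [CharP K p] {f : ℕ → K}
    (S : IsBlockSequence q w e f) (hp : 3 ≤ p) (hw : w = p ^ c) (hwr : w = r * q) (hr3 : 3 ≤ r)
    (hr : (r : K) = 0) (hq : q = p ^ h) (he : e = p ^ β) (hβ : β < h) {E ℓ : ℕ → ℕ}
    (hE0 : E 0 = 2 * q) (hE : ∀ t, E (t + 1) = E t + ℓ (t + 1))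
    (hgap : ∀ t, IsGap f (E t) (ℓ (t + 1))) (hshort : ∀ t, 1 ≤ t → t + 2 ≤ r → ℓ t = q)
    (hlong : ℓ (r - 1) + e = 2 * q) (hone : ∀ t, t < r → f (E t) = 1) (t : ℕ) :
    f (E t) = 1 ∧ (¬ (r - 1) ∣ t → ℓ t = q) ∧
      (0 < t → (r - 1) ∣ t → ℓ t = 2 * q ∨ ℓ t + e = 2 * q) := by
  have h3 : 3 * e ≤ q := by rw [he, hq]; exact three_mul_pow_le hp hβ
  have he0 : 0 < e := he ▸ pow_pos (by omega) β
  have S' := S.toIsCentralizerSequence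
  have hw2 : w = (r - 2) * q + 2 * q := by
    rw [hwr, ← add_mul]; congr 1; omega
  have hE1 : ∀ t, 1 ≤ E t := by
    intro t
    induction t with
    | zero => omega
    | succ t ih => rw [hE]; omega
  have hrun : ∀ s n, (∀ a, 1 ≤ a → a ≤ n → ℓ (s + a) = q) → E (s + n) = E s + n * q := by
    intro s n
    induction n with
    | zero => simp
    | succ n ih =>
      intro hn
      rw [← add_assoc, hE, ih fun a h1 h2 => hn a h1 (by omega), add_assoc s n 1,
        hn (n + 1) (by omega) le_rfl]
      ring
  -- The last clause is the invariant: r - 1 consecutive constituents always include exactly one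
  -- long one, so their total length is w or w - e.
  have key : ∀ s, (∀ t, t ≤ s + (r - 1) → f (E t) = 1 ∧ (¬ (r - 1) ∣ t → ℓ t = q) ∧
        (0 < t → (r - 1) ∣ t → ℓ t = 2 * q ∨ ℓ t + e = 2 * q)) ∧
      (E (s + (r - 1)) = E s + w ∨ E (s + (r - 1)) + e = E s + w) := by
    intro s
    induction s with
    | zero =>
      refine ⟨fun t ht => ⟨hone t (by omega), fun hnd => ?_, fun h0 hd => ?_⟩, Or.inr ?_⟩
      · rcases Nat.eq_zero_or_pos t with rfl | h0
        · simp at hnd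
        · refine hshort t h0 ?_
          by_contra hlt
          exact hnd (by rw [show t = r - 1 by omega])
      · have := Nat.le_of_dvd h0 hd
        rw [show t = r - 1 by omega]
        exact Or.inr hlong
      · have h1 := hrun 0 (r - 2) fun a h1 h2 => by rw [zero_add]; exact hshort a h1 (by omega)
        have h2 := hE (r - 2)
        rw [show r - 2 + 1 = r - 1 by omega] at h2
        rw [zero_add] at h1 ⊢
        omega
    | succ s ih =>
      obtain ⟨hc, hd⟩ := ih
      have hEn := hE (s + (r - 1))
      have hgn := hgap (s + (r - 1))
      have hgs := hgap s
      have hEs := hE s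
      have hfs := (hc s (by omega)).1
      have hfn := (hc (s + (r - 1)) le_rfl).1
      have hdvd : (r - 1) ∣ s + (r - 1) + 1 ↔ (r - 1) ∣ s + 1 := by
        rw [add_right_comm]
        exact Nat.dvd_add_self_right
      suffices hs : f (E (s + (r - 1) + 1)) = 1 ∧
          (¬ (r - 1) ∣ s + 1 → ℓ (s + (r - 1) + 1) = q) ∧
          ((r - 1) ∣ s + 1 → ℓ (s + (r - 1) + 1) = 2 * q ∨ ℓ (s + (r - 1) + 1) + e = 2 * q) ∧
          (E (s + (r - 1) + 1) = E (s + 1) + w ∨ E (s + (r - 1) + 1) + e = E (s + 1) + w) by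
        rw [add_right_comm s 1]
        refine ⟨fun t ht => ?_, hs.2.2.2⟩
        rcases eq_or_lt_of_le ht with rfl | hlt
        · rw [hdvd]
          exact ⟨hs.1, hs.2.1, fun _ => hs.2.2.1⟩
        · exact hc t (by omega)
      generalize ℓ (s + (r - 1) + 1) = m at *
      rw [hEn]
      by_cases hds : (r - 1) ∣ s + 1
      · have hrs : E (s + 1 + (r - 2)) = E (s + 1) + (r - 2) * q := by
          refine hrun _ _ fun a h1 h2 => (hc (s + 1 + a) (by omega)).2.1 fun hd' => ?_
          have := Nat.le_of_dvd (by omega) ((Nat.dvd_add_right hds).mp hd')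
          omega
        have hne : s + 1 + (r - 2) = s + (r - 1) := by omega
        rw [hne] at hrs
        have hval : q < m → f (E (s + (r - 1)) + m) = 1 := by
          refine S.eq_one_of_long_gap (by omega) hr hw hwr hq (hE1 (s + 1)) (fun a ha => ?_) hrs hgn
          have : E (s + 1 + a) = E (s + 1) + a * q := by
            refine hrun _ _ fun b h1 h2 => (hc (s + 1 + b) (by omega)).2.1 fun hd' => ?_
            have := Nat.le_of_dvd (by omega) ((Nat.dvd_add_right hds).mp hd')
            omega
          rw [← this]
          exact (hc (s + 1 + a) (by omega)).1
        have hm : q < m ∧ (m = 2 * q ∨ m + e = 2 * q) := by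
          rcases (hc (s + 1) (by omega)).2.2 (by omega) hds with hl | hl
          · rw [hl] at hgs
            exact S.long_gap_after_long hp hw hq he hβ (hE1 s) hfs (by omega) hfn hgs hgn hval
          · rw [show ℓ (s + 1) = 2 * q - e by omega] at hgs
            exact S.long_gap_after_short hp hw hq he hβ (hE1 s) (hE1 _) hfs (by omega) hfn hgs hgn
        exact ⟨hval hm.1, fun hn => absurd hds hn, fun _ => hm.2, by omega⟩
      · have hl := (hc (s + 1) (by omega)).2.1 hds
        rw [hl] at hEs hgs
        have hfq : f (E s + q) = 1 := by
          rw [← hEs]; exact (hc (s + 1) (by omega)).1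
        have hm : m = q ∧ f (E (s + (r - 1)) + m) = 1 := by
          rcases hd with hd | hd
          · have htr : ∀ a, a + e < 2 * q → f (E (s + (r - 1)) + a) = f (E s + a) := fun a ha => by
              rw [hd]
              exact S.eq_of_eq_add hw (hE1 s) (by simp [hfs]) (by rw [← hd, hfn, hfs]) ha
            have hgq : IsGap f (E (s + (r - 1))) q := by
              refine ⟨by omega, ?_, fun a h0 ha => ?_⟩
              · rw [htr q (by omega), hfq]; exact one_ne_zero
              · rw [htr a (by omega)]; exact hgs.eq_zero a h0 ha
            obtain rfl := hgn.eq hgq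
            exact ⟨rfl, by rw [htr m (by omega), hfq]⟩
          · exact S.gap_of_gap_eq_add hp hw hq he hβ (hE1 s) (hE1 _) hfs hfq hd (by simp [hfn]) hgn
        exact ⟨hm.2, fun _ => hm.1, fun hn => absurd hn hds, by omega⟩
  exact (key t).1 t (by omega)

end MaxClass

/-! ### From structure constants to the sequence f -/

namespace MaxClass

open Finset

/-- Structure constants of an algebra of maximal class with respect to homogeneous elements
`u i`, where `a i`, `b i` describe `ad x`, `ad y` and `u 1 = y`, yield over `F(X)` a sequence that
satisfies the relations of a centralizer sequence. -/
theorem rel_of_structure_constants {F : Type*} [Field F] {a b : ℕ → F} {s : ℕ → ℕ → F}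
    (hab : ∀ i, 1 ≤ i → a i ≠ 0 ∨ b i ≠ 0) (hs : ∀ j, 1 ≤ j → s 1 j = b j)
    (hx : ∀ i j, 1 ≤ i → 1 ≤ j → a i * s (i + 1) j = s i j * a (i + j) - a j * s i (j + 1))
    (hy : ∀ i j, 1 ≤ i → 1 ≤ j → b i * s (i + 1) j = s i j * b (i + j) - b j * s i (j + 1)) :
    ∃ f : ℕ → RatFunc F,
      (∀ k j, 1 ≤ j →
        diffIter f k j * (f (k + 1 + j) - f (k + 1)) = diffIter f k (j + 1) * (f j - f (k + 1))) ∧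
      ∀ i, 1 ≤ i → (f i = 0 ↔ b i = 0) ∧ (f i = 1 ↔ a i = 0) := by
  set X : RatFunc F := RatFunc.X with hX
  set c : ℕ → RatFunc F := fun i => RatFunc.C (a i) + X * RatFunc.C (b i) with hc
  have hX0 : X ≠ 0 := RatFunc.X_ne_zero
  have hc0 : ∀ i, 1 ≤ i → c i ≠ 0 := by
    intro i hi h0
    have h1 : algebraMap (Polynomial F) (RatFunc F)
        (Polynomial.C (a i) + Polynomial.X * Polynomial.C (b i)) = 0 := by
      rw [map_add, map_mul, RatFunc.algebraMap_C, RatFunc.algebraMap_X, RatFunc.algebraMap_C]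
      exact h0
    have h2 := (map_eq_zero_iff _ (RatFunc.algebraMap_injective F)).mp h1
    have ha : a i = 0 := by simpa using congrArg (fun P => Polynomial.coeff P 0) h2
    have hb : b i = 0 := by
      simpa [Polynomial.coeff_C] using congrArg (fun P => Polynomial.coeff P 1) h2
    rcases hab i hi with h | h
    · exact h ha
    · exact h hb
  -- With z = x + Xy acting by c, the vectors v_i = g i • u i satisfy v_1 = Xy and [v_i, z] =
  -- v_{i+1}.
  set g : ℕ → RatFunc F := fun i => X * ∏ k ∈ Ico 1 i, c k with hg
  have hg1 : g 1 = X := by simp [hg]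
  have hgs : ∀ i, 1 ≤ i → g (i + 1) = g i * c i := fun i hi => by
    simp only [hg]
    rw [prod_Ico_succ_top hi, mul_assoc]
  have hg0 : ∀ i, g i ≠ 0 := fun i => mul_ne_zero hX0 <| prod_ne_zero_iff.mpr fun k hk =>
    hc0 k (mem_Ico.mp hk).1
  clear_value g
  set f : ℕ → RatFunc F := fun i => X * RatFunc.C (b i) / c i with hf
  have hfc : ∀ i, 1 ≤ i → f i * c i = X * RatFunc.C (b i) := fun i hi =>
    div_mul_cancel₀ _ (hc0 i hi)
  have hxc : ∀ i j, 1 ≤ i → 1 ≤ j → c i * RatFunc.C (s (i + 1) j)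
      = RatFunc.C (s i j) * c (i + j) - c j * RatFunc.C (s i (j + 1)) := by
    intro i j hi hj
    have h1 := congrArg (RatFunc.C : F →+* RatFunc F) (hx i j hi hj)
    have h2 := congrArg (RatFunc.C : F →+* RatFunc F) (hy i j hi hj)
    simp only [map_mul, map_sub] at h1 h2
    simp only [hc]
    linear_combination h1 + X * h2
  have hyc : ∀ i j, 1 ≤ i → 1 ≤ j → RatFunc.C (b i) * RatFunc.C (s (i + 1) j)
      = RatFunc.C (s i j) * RatFunc.C (b (i + j)) - RatFunc.C (b j) * RatFunc.C (s i (j + 1)) := by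
    intro i j hi hj
    have h2 := congrArg (RatFunc.C : F →+* RatFunc F) (hy i j hi hj)
    simpa only [map_mul, map_sub] using h2
  -- This expresses [v_j, v_{k+1}] = `diffIter f k j` • v_{k+1+j}.
  have hd : ∀ k j, 1 ≤ j → diffIter f k j
      = RatFunc.C (s (k + 1) j) * (g (k + 1) * g j / g (k + 1 + j)) := by
    intro k
    induction k with
    | zero =>
      intro j hj
      have h1 := hc0 j hj
      have h2 := hg0 j
      rw [diffIter_zero, zero_add, hs j hj, add_comm 1 j, hgs j hj, hg1]
      simp only [hf]
      field_simp
    | succ k ih =>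
      intro j hj
      rw [diffIter_succ, ih j hj, ih (j + 1) (by omega), hgs (k + 1) (by omega), hgs j hj,
        show k + 1 + 1 + j = k + 1 + j + 1 by ring, show k + 1 + (j + 1) = k + 1 + j + 1 by ring,
        hgs (k + 1 + j) (by omega)]
      have h1 := hc0 (k + 1 + j) (by omega)
      have h2 := hg0 (k + 1 + j)
      field_simp
      linear_combination (-g (k + 1) * g j) * hxc (k + 1) j (by omega) hj
  refine ⟨f, fun k j hj => ?_, fun i hi => ⟨?_, ?_⟩⟩
  · rw [hd k j hj, hd k (j + 1) (by omega), hgs j hj,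
      show k + 1 + (j + 1) = k + 1 + j + 1 by ring, hgs (k + 1 + j) (by omega)]
    have h1 := hc0 (k + 1 + j) (by omega)
    have h2 := hg0 (k + 1 + j)
    have e1 := hfc (k + 1) (by omega)
    have e2 := hfc (k + 1 + j) (by omega)
    have e3 := hfc j hj
    have e4 := hxc (k + 1) j (by omega) hj
    have e5 := hyc (k + 1) j (by omega) hj
    -- The Jacobi identity for v_j, v_{k+1} and Xy - f_{k+1} z, the last of which commutes with
    -- v_{k+1}.
    have key : RatFunc.C (s (k + 1) j) * c (k + 1 + j) * (f (k + 1 + j) - f (k + 1))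
        = RatFunc.C (s (k + 1) (j + 1)) * c j * (f j - f (k + 1)) := by
      linear_combination RatFunc.C (s (k + 1) j) * e2 - RatFunc.C (s (k + 1) (j + 1)) * e3
        + f (k + 1) * e4 - X * e5 - RatFunc.C (s (k + 1 + 1) j) * e1
    generalize f (k + 1 + j) - f (k + 1) = A at *
    generalize f j - f (k + 1) = B at *
    field_simp
    linear_combination g (k + 1) * g j * key
  · simp only [hf]
    rw [div_eq_zero_iff, or_iff_left (hc0 i hi), mul_eq_zero, or_iff_right hX0,
      map_eq_zero_iff _ (RatFunc.C : F →+* RatFunc F).injective]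
  · simp only [hf]
    rw [div_eq_one_iff_eq (hc0 i hi)]
    simp only [hc]
    rw [right_eq_add, map_eq_zero_iff _ (RatFunc.C : F →+* RatFunc F).injective]

end MaxClass

/-! ### Two-step centralizers and structure constants -/

namespace MaxClass

namespace IsMaximalClass

variable {F L : Type*} [Field F] [LieRing L] [LieAlgebra F L] {𝒜 : ℕ → Submodule F L}

theorem finite_component (hL : IsMaximalClass 𝒜) (i : ℕ) : Module.Finite F (𝒜 i) := by
  rcases i with _ | _ | i
  · rw [hL.zero_eq_bot]
    infer_instance
  · exact Module.finite_of_rank_eq_nat (n := 2) (by simpa using hL.rank_one)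
  · rw [← Module.rank_lt_aleph0_iff]
    exact (hL.rank_le_one (i + 2) (by omega)).trans_lt Cardinal.one_lt_aleph0

theorem ne_bot (hL : IsMaximalClass 𝒜) (hinf : ¬ Module.Finite F L) {i : ℕ} (hi : 1 ≤ i) :
    𝒜 i ≠ ⊥ := by
  intro hbot
  have hzero : ∀ n, i ≤ n → 𝒜 n = ⊥ := by
    intro n hn
    induction n, hn using Nat.le_induction with
    | base => exact hbot
    | succ n hn ih =>
      rw [← hL.span_lie n (by omega), Submodule.span_eq_bot]
      rintro c ⟨a, ha, b, -, rfl⟩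
      rw [ih, Submodule.mem_bot] at ha
      rw [ha, zero_lie]
  apply hinf
  have htop : (⨆ n : Fin i, 𝒜 n) = ⊤ := by
    rw [eq_top_iff, ← hL.isInternal.submodule_iSup_eq_top]
    refine iSup_le fun n => ?_
    by_cases hn : n < i
    · exact le_iSup (fun n : Fin i => 𝒜 n) ⟨n, hn⟩
    · rw [hzero n (by omega)]
      exact bot_le
  have := hL.finite_component
  have hfin : Module.Finite F (⨆ n : Fin i, 𝒜 n : Submodule F L) := inferInstance
  rw [htop] at hfin
  exact Module.Finite.equiv (Submodule.topEquiv (R := F) (M := L))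

theorem exists_smul_eq (hL : IsMaximalClass 𝒜) {i : ℕ} (hi : 2 ≤ i) {u v : L} (hu : u ∈ 𝒜 i)
    (hu0 : u ≠ 0) (hv : v ∈ 𝒜 i) : ∃ t : F, v = t • u := by
  obtain ⟨v₀, hv₀⟩ := rank_le_one_iff.mp (hL.rank_le_one i hi)
  obtain ⟨s, hs⟩ := hv₀ ⟨u, hu⟩
  obtain ⟨t, ht⟩ := hv₀ ⟨v, hv⟩
  have hs' : s • (v₀ : L) = u := congrArg Subtype.val hs
  have ht' : t • (v₀ : L) = v := congrArg Subtype.val ht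
  have hs0 : s ≠ 0 := by
    rintro rfl
    exact hu0 (by rw [← hs', zero_smul])
  exact ⟨t * s⁻¹, by rw [← hs', ← ht', smul_smul, mul_assoc, inv_mul_cancel₀ hs0, mul_one]⟩

theorem finrank_one (hL : IsMaximalClass 𝒜) : Module.finrank F (𝒜 1) = 2 :=
  Module.finrank_eq_of_rank_eq hL.rank_one

/-- It is the kernel of a nonzero map from the plane `𝒜 1` to the line `𝒜 (i + 1)`. -/
theorem finrank_twoStepCentralizer (hL : IsMaximalClass 𝒜) (hinf : ¬ Module.Finite F L) {i : ℕ}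
    (hi : 2 ≤ i) : Module.finrank F (twoStepCentralizer 𝒜 i) = 1 := by
  have hfin := hL.finite_component 1
  obtain ⟨u, hu, hu0⟩ := Submodule.exists_mem_ne_zero_of_ne_bot (hL.ne_bot hinf (i := i) (by omega))
  have hle : twoStepCentralizer 𝒜 i ≤ 𝒜 1 := fun a ha => ha.1
  have hmem : ∀ a ∈ 𝒜 1, ⁅u, a⁆ = 0 → a ∈ twoStepCentralizer 𝒜 i := by
    refine fun a ha h0 => ⟨ha, fun b hb => ?_⟩
    obtain ⟨t, rfl⟩ := hL.exists_smul_eq hi hu hu0 hb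
    rw [smul_lie, h0, smul_zero]
  have hlt : twoStepCentralizer 𝒜 i < 𝒜 1 := by
    refine lt_of_le_of_ne hle fun heq => hL.ne_bot hinf (i := i + 1) (by omega) ?_
    rw [← hL.span_lie i (by omega), Submodule.span_eq_bot]
    rintro c ⟨a, ha, b, hb, rfl⟩
    rw [← heq] at hb
    exact hb.2 a ha
  have h2 := Submodule.finrank_lt_finrank_of_lt hlt
  rw [hL.finrank_one] at h2
  have hfin' : Module.Finite F (twoStepCentralizer 𝒜 i) :=
    Submodule.finiteDimensional_of_le hle
  suffices h0 : Module.finrank F (twoStepCentralizer 𝒜 i) ≠ 0 by omega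
  rw [Ne, Submodule.finrank_eq_zero]
  intro hbot
  have hinj : ∀ a ∈ 𝒜 1, ⁅u, a⁆ = 0 → a = 0 := fun a ha h0 => by
    simpa [hbot] using hmem a ha h0
  let φ : 𝒜 1 →ₗ[F] 𝒜 (i + 1) :=
    { toFun := fun a => ⟨⁅u, (a : L)⁆, hL.lie_mem i 1 u hu a a.2⟩
      map_add' := fun a b => Subtype.ext (lie_add u (a : L) b)
      map_smul' := fun t a => Subtype.ext (lie_smul t u (a : L)) }
  have hφ : Function.Injective φ := by
    rw [← LinearMap.ker_eq_bot, LinearMap.ker_eq_bot']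
    intro a ha
    exact Subtype.ext (hinj a a.2 (congrArg Subtype.val ha))
  have h3 := LinearMap.rank_le_of_injective φ hφ
  rw [hL.rank_one] at h3
  have h4 := h3.trans (hL.rank_le_one (i + 1) (by omega))
  norm_num at h4

theorem twoStepCentralizer_eq_span (hL : IsMaximalClass 𝒜) (hinf : ¬ Module.Finite F L) {i : ℕ}
    (hi : 2 ≤ i) {a : L} (ha : a ∈ twoStepCentralizer 𝒜 i) (ha0 : a ≠ 0) :
    twoStepCentralizer 𝒜 i = Submodule.span F {a} := by
  have hfr := hL.finrank_twoStepCentralizer hinf hi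
  have hfin : Module.Finite F (twoStepCentralizer 𝒜 i) :=
    Module.finite_of_finrank_pos (by omega)
  symm
  apply Submodule.eq_of_le_of_finrank_eq
  · rwa [Submodule.span_singleton_le_iff_mem]
  · rw [hfr, finrank_span_singleton ha0]

theorem exists_centralizer_sequence (hL : IsMaximalClass 𝒜) (hinf : ¬ Module.Finite F L) {N : ℕ}
    (hN : 2 ≤ N) (hne : twoStepCentralizer 𝒜 N ≠ twoStepCentralizer 𝒜 2) :
    ∃ f : ℕ → RatFunc F,
      (∀ k j, 1 ≤ j →
        diffIter f k j * (f (k + 1 + j) - f (k + 1)) = diffIter f k (j + 1) * (f j - f (k + 1))) ∧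
      f 1 = 0 ∧
      ∀ i, 2 ≤ i → (f i = 0 ↔ twoStepCentralizer 𝒜 i = twoStepCentralizer 𝒜 2) ∧
        (f i = 1 ↔ twoStepCentralizer 𝒜 i = twoStepCentralizer 𝒜 N) := by
  have hnb : ∀ i, 2 ≤ i → twoStepCentralizer 𝒜 i ≠ ⊥ := fun i hi hbot => by
    have := hL.finrank_twoStepCentralizer hinf hi
    rw [hbot, finrank_bot] at this
    omega
  obtain ⟨y, hy, hy0⟩ := Submodule.exists_mem_ne_zero_of_ne_bot (hnb 2 le_rfl)
  obtain ⟨x, hx, hx0⟩ := Submodule.exists_mem_ne_zero_of_ne_bot (hnb N hN)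
  have hspan : ∀ a ∈ 𝒜 1, ∃ s t : F, a = s • x + t • y := by
    have hli : LinearIndependent F ![x, y] := by
      rw [LinearIndependent.pair_iff' hx0]
      intro t ht
      refine hne ?_
      have hyN : y ∈ twoStepCentralizer 𝒜 N := ht ▸ Submodule.smul_mem _ t hx
      rw [hL.twoStepCentralizer_eq_span hinf hN hyN hy0,
        hL.twoStepCentralizer_eq_span hinf le_rfl hy hy0]
    have hfin := hL.finite_component 1
    have heq : Submodule.span F {x, y} = 𝒜 1 := by
      apply Submodule.eq_of_le_of_finrank_eq
      · rw [Submodule.span_le]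
        rintro a (rfl | rfl)
        · exact hx.1
        · exact hy.1
      · have h1 := finrank_span_eq_card hli
        rw [Matrix.range_cons, Matrix.range_cons, Matrix.range_empty, Set.union_empty,
          Set.singleton_union] at h1
        rw [h1, hL.finrank_one, Fintype.card_fin]
    intro a ha
    rw [← heq, Submodule.mem_span_pair] at ha
    obtain ⟨s, t, h⟩ := ha
    exact ⟨s, t, h.symm⟩
  have hgen : ∀ i, ∃ u : L, 1 ≤ i → u ∈ 𝒜 i ∧ u ≠ 0 ∧ (i = 1 → u = y) := by
    intro i
    rcases Nat.lt_or_ge i 2 with hi | hi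
    · exact ⟨y, fun h1 => ⟨by obtain rfl : i = 1 := by omega
                              exact hy.1, hy0, fun _ => rfl⟩⟩
    · obtain ⟨u, hu, hu0⟩ :=
        Submodule.exists_mem_ne_zero_of_ne_bot (hL.ne_bot hinf (i := i) (by omega))
      exact ⟨u, fun _ => ⟨hu, hu0, fun h => by omega⟩⟩
  choose u hu using hgen
  have hu1 : u 1 = y := (hu 1 le_rfl).2.2 rfl
  have hcoef : ∀ i v, v ∈ 𝒜 (i + 1) → ∃ t : F, 1 ≤ i → v = t • u (i + 1) := fun i v hv => by
    by_cases hi : 1 ≤ i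
    · obtain ⟨t, ht⟩ := hL.exists_smul_eq (by omega) (hu (i + 1) (by omega)).1
        (hu (i + 1) (by omega)).2.1 hv
      exact ⟨t, fun _ => ht⟩
    · exact ⟨0, fun h => absurd h hi⟩
  have hscal : ∀ v ∈ 𝒜 1, ∃ a : ℕ → F, ∀ i, 1 ≤ i → ⁅u i, v⁆ = a i • u (i + 1) := by
    intro v hv
    have : ∀ i, ∃ t : F, 1 ≤ i → ⁅u i, v⁆ = t • u (i + 1) := fun i => by
      by_cases hi : 1 ≤ i
      · exact hcoef i _ (hL.lie_mem i 1 _ (hu i hi).1 v hv)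
      · exact ⟨0, fun h => absurd h hi⟩
    exact ⟨fun i => (this i).choose, fun i => (this i).choose_spec⟩
  obtain ⟨a, ha⟩ := hscal x hx.1
  obtain ⟨b, hb⟩ := hscal y hy.1
  have hs : ∀ i j, ∃ t : F, 1 ≤ i → 1 ≤ j → ⁅u j, u i⁆ = t • u (i + j) := by
    intro i j
    by_cases h : 1 ≤ i ∧ 1 ≤ j
    · obtain ⟨t, ht⟩ := hL.exists_smul_eq (i := i + j) (by omega) (hu (i + j) (by omega)).1
        (hu (i + j) (by omega)).2.1
        (by rw [add_comm]; exact hL.lie_mem j i _ (hu j h.2).1 _ (hu i h.1).1)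
      exact ⟨t, fun _ _ => ht⟩
    · exact ⟨0, fun h1 h2 => absurd ⟨h1, h2⟩ h⟩
  choose s hs using hs
  have hu0 : ∀ i, 1 ≤ i → u i ≠ 0 := fun i hi => (hu i hi).2.1
  have hcancel : ∀ i, 1 ≤ i → ∀ t t' : F, t • u i = t' • u i → t = t' := fun i hi t t' h =>
    smul_left_injective F (hu0 i hi) h
  have hrel : ∀ (v : L) (c : ℕ → F), (∀ i, 1 ≤ i → ⁅u i, v⁆ = c i • u (i + 1)) →
      ∀ i j, 1 ≤ i → 1 ≤ j → c i * s (i + 1) j = s i j * c (i + j) - c j * s i (j + 1) := by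
    intro v c hc i j hi hj
    apply hcancel (i + j + 1) (by omega)
    have h1 : ⁅u j, ⁅u i, v⁆⁆ = ⁅⁅u j, u i⁆, v⁆ - ⁅⁅u j, v⁆, u i⁆ := by
      rw [leibniz_lie (u j) (u i) v, ← lie_skew ⁅u j, v⁆ (u i)]
      abel
    rw [hc i hi, hs i j hi hj, hc j hj, lie_smul, smul_lie, smul_lie, hs (i + 1) j (by omega) hj,
      hc (i + j) (by omega), hs i (j + 1) hi (by omega), add_right_comm i 1 j, ← add_assoc,
      smul_smul, smul_smul, smul_smul, ← sub_smul] at h1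
    exact h1
  have hbot : ∀ i, 1 ≤ i → (∀ v ∈ 𝒜 i, ∀ w ∈ 𝒜 1, ⁅v, w⁆ = 0) → False := fun i hi h => by
    apply hL.ne_bot hinf (i := i + 1) (by omega)
    rw [← hL.span_lie i hi, Submodule.span_eq_bot]
    rintro c ⟨v, hv, w, hw, rfl⟩
    exact h v hv w hw
  have hb1 : b 1 = 0 := by
    have h1 := hb 1 le_rfl
    rw [hu1, lie_self] at h1
    exact (smul_eq_zero.mp h1.symm).resolve_right (hu0 2 (by omega))
  have hab : ∀ i, 1 ≤ i → a i ≠ 0 ∨ b i ≠ 0 := by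
    intro i hi
    by_contra! h
    have hux : ⁅u i, x⁆ = 0 := by rw [ha i hi, h.1, zero_smul]
    have huy : ⁅u i, y⁆ = 0 := by rw [hb i hi, h.2, zero_smul]
    refine hbot i hi fun v hv w hw => ?_
    obtain ⟨t₁, t₂, rfl⟩ := hspan w hw
    rcases Nat.lt_or_ge i 2 with h2 | h2
    · obtain rfl : i = 1 := by omega
      obtain ⟨t₃, t₄, rfl⟩ := hspan v hv
      rw [hu1] at hux
      have hxy : ⁅x, y⁆ = 0 := by rw [← lie_skew, hux, neg_zero]
      simp [hux, hxy]
    · obtain ⟨t, rfl⟩ := hL.exists_smul_eq h2 (hu i hi).1 (hu0 i hi) hv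
      simp [hux, huy]
  obtain ⟨f, hf, hf01⟩ := rel_of_structure_constants (s := s) hab
    (fun j hj => hcancel (j + 1) (by omega) _ _ (by
      rw [← hb j hj, ← hu1, hs 1 j le_rfl hj, add_comm 1 j]))
    (hrel x a ha) (hrel y b hb)
  refine ⟨f, hf, ((hf01 1 le_rfl).1).mpr hb1, fun i hi => ?_⟩
  have hcen : ∀ v ∈ 𝒜 1, v ≠ 0 → ∀ M, 2 ≤ M → v ∈ twoStepCentralizer 𝒜 M →
      (⁅u i, v⁆ = 0 ↔ twoStepCentralizer 𝒜 i = twoStepCentralizer 𝒜 M) := by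
    intro v hv hv0 M hM hvM
    constructor
    · intro h0
      have hvi : v ∈ twoStepCentralizer 𝒜 i := by
        refine ⟨hv, fun w hw => ?_⟩
        obtain ⟨t, rfl⟩ := hL.exists_smul_eq hi (hu i (by omega)).1 (hu0 i (by omega)) hw
        rw [smul_lie, h0, smul_zero]
      rw [hL.twoStepCentralizer_eq_span hinf hi hvi hv0,
        hL.twoStepCentralizer_eq_span hinf hM hvM hv0]
    · intro heq
      rw [← heq] at hvM
      exact hvM.2 _ (hu i (by omega)).1
  have hz : ∀ t : F, t • u (i + 1) = 0 ↔ t = 0 := fun t => by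
    rw [smul_eq_zero, or_iff_left (hu0 (i + 1) (by omega))]
  rw [(hf01 i (by omega)).1, (hf01 i (by omega)).2, ← hcen y hy.1 hy0 2 le_rfl hy,
    ← hcen x hx.1 hx0 N hN hx, ha i (by omega), hb i (by omega), hz, hz]
  exact ⟨Iff.rfl, Iff.rfl⟩

end IsMaximalClass

end MaxClass

/-! ### Words and concatenations -/

namespace MaxClass

theorem isConcatenationOf_of_blocks {S : Set (List ℕ)} {ℓ : ℕ → ℕ} {M : ℕ} (hM : M ≠ 0)
    (h : ∀ n, (List.range M).map (fun v => ℓ (n * M + v)) ∈ S) : IsConcatenationOf S ℓ := by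
  refine ⟨fun n => (List.range M).map fun v => ℓ (n * M + v), fun n => ⟨h n, ?_⟩, fun n => ?_⟩
  · simpa using hM
  · have key : (List.range n).flatMap (fun n => (List.range M).map fun v => ℓ (n * M + v))
        = (List.range (n * M)).map ℓ := by
      induction n with
      | zero => simp
      | succ n ih =>
        rw [List.range_succ, List.flatMap_append, ih, Nat.succ_mul, List.range_add]
        simp [Function.comp_def]
    rw [key]
    simp [initialSegment]

theorem initialSegment_getElem? {ℓ : ℕ → ℕ} {N t : ℕ} (ht : t < N) :
    (initialSegment ℓ N)[t]? = some (ℓ t) := by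
  simp [initialSegment, ht]

theorem initialSegment_eq_pattern {ℓ : ℕ → ℕ} {r a b c : ℕ} (hr : 2 ≤ r)
    (h : initialSegment ℓ r = [a] ++ List.replicate (r - 2) b ++ [c]) :
    ℓ 0 = a ∧ (∀ t, 1 ≤ t → t + 2 ≤ r → ℓ t = b) ∧ ℓ (r - 1) = c := by
  have hget : ∀ t, t < r → some (ℓ t) = ([a] ++ List.replicate (r - 2) b ++ [c])[t]? :=
    fun t ht => by rw [← h, initialSegment_getElem? ht]
  refine ⟨?_, fun t h1 h2 => ?_, ?_⟩
  · simpa using hget 0 (by omega)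
  · have h3 := hget t (by omega)
    obtain ⟨t, rfl⟩ := Nat.exists_eq_add_of_le' h1
    rw [List.getElem?_append_left (by simp; omega), List.singleton_append,
      List.getElem?_cons_succ, List.getElem?_replicate, if_pos (by omega)] at h3
    exact Option.some.inj h3
  · have h3 := hget (r - 1) (by omega)
    rw [List.getElem?_append_right (by simp; omega)] at h3
    have h4 : r - 1 - ([a] ++ List.replicate (r - 2) b).length = 0 := by simp; omega
    rw [h4] at h3
    simpa using h3

end MaxClass

/-! ### The main theorem -/

theorem mainTheorem4 {F L : Type*} [Field F] [LieRing L] [LieAlgebra F L]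
    (p : ℕ) [Fact p.Prime] (hp : Odd p) [CharP F p]
    (𝒜 : ℕ → Submodule F L) (hL : MaxClass.IsMaximalClass 𝒜) (hinf : ¬ Module.Finite F L)
    (h k β q r : ℕ) (hq : q = p ^ h) (hk : 1 ≤ k) (hr : r = p ^ k) (hβ : β < h)
    (hseg : MaxClass.initialSegment (MaxClass.constituentLength 𝒜) r
      = [2 * q] ++ List.replicate (r - 2) q ++ [2 * q - p ^ β])
    (htwo : ∀ i, 2 ≤ i → i ≤ MaxClass.constituentEnd 𝒜 (r - 1) →
      MaxClass.twoStepCentralizer 𝒜 i = MaxClass.twoStepCentralizer 𝒜 2 ∨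
      MaxClass.twoStepCentralizer 𝒜 i = MaxClass.twoStepCentralizer 𝒜 (2 * q)) :
    (MaxClass.twoStepCentralizer 𝒜 '' {i | 2 ≤ i}).ncard = 2 ∧
    {n | MaxClass.IsConstituentEnd 𝒜 n}.Infinite ∧
    MaxClass.IsConcatenationOf
      {[2 * q] ++ List.replicate (r - 2) q, [2 * q - p ^ β] ++ List.replicate (r - 2) q}
      (MaxClass.constituentLength 𝒜) := by
  open MaxClass in
  have hpp : p.Prime := Fact.out
  have hp3 : 3 ≤ p := by
    have h2 := hpp.two_le
    rcases hp with ⟨t, ht⟩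
    omega
  have hr3 : 3 ≤ r := by
    rw [hr]
    exact hp3.trans (Nat.le_self_pow (by omega) p)
  have h3e : 3 * p ^ β ≤ q := hq ▸ three_mul_pow_le hp3 hβ
  have he0 : 0 < p ^ β := pow_pos hpp.pos β
  have hchar : CharP (RatFunc F) p :=
    charP_of_injective_algebraMap (algebraMap F (RatFunc F)).injective p
  have hr0 : (r : RatFunc F) = 0 := by
    rw [CharP.cast_eq_zero_iff (RatFunc F) p, hr]
    exact dvd_pow_self p (by omega)
  obtain ⟨hl0, hlq, hlr⟩ := initialSegment_eq_pattern (by omega) hseg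
  have hE0 : constituentEnd 𝒜 0 = 2 * q := hl0
  have hend0 : IsConstituentEnd 𝒜 (2 * q) := by
    -- `Nat.nth` defaults to 0 when there is no such element, so the value 2q > 0 is a genuine end.
    have := Nat.nth_mem_of_ne_zero (p := IsConstituentEnd 𝒜) (n := 0) (by
      change constituentEnd 𝒜 0 ≠ 0
      omega)
    rw [← hE0]
    exact this
  obtain ⟨f, hrel, hf1, hf01⟩ := hL.exists_centralizer_sequence hinf hend0.1 hend0.2
  have hend : ∀ n, IsConstituentEnd 𝒜 n ↔ 2 ≤ n ∧ f n ≠ 0 := fun n =>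
    and_congr_right fun hn => not_congr (hf01 n hn).1.symm
  have S : IsCentralizerSequence q f := by
    refine ⟨hrel, fun i hi hiq => ?_, (hf01 _ hend0.1).2.mpr rfl⟩
    rcases Nat.lt_or_ge i 2 with h2 | h2
    · obtain rfl : i = 1 := by omega
      exact hf1
    · by_contra hne
      have hlt : i < Nat.nth (IsConstituentEnd 𝒜) 0 := by
        change i < constituentEnd 𝒜 0
        omega
      rw [Nat.nth_zero] at hlt
      exact Nat.notMem_of_lt_sInf hlt ((hend i).mpr ⟨h2, hne⟩)
  have hinfinite : {n | IsConstituentEnd 𝒜 n}.Infinite := by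
    refine Set.infinite_of_forall_exists_gt fun n => ?_
    induction n with
    | zero => exact ⟨2 * q, hend0, by omega⟩
    | succ n ih =>
      obtain ⟨m, hm, hnm⟩ := ih
      have hm' := (hend m).mp hm
      obtain ⟨g, -, hg⟩ := S.exists_gap (by omega) (by omega) hm'.2
      have := hg.pos
      exact ⟨m + g, (hend _).mpr ⟨by omega, hg.ne_zero⟩, by omega⟩
  have hmem : ∀ t, IsConstituentEnd 𝒜 (constituentEnd 𝒜 t) :=
    fun t => Nat.nth_mem_of_infinite hinfinite t
  have hmono : StrictMono (constituentEnd 𝒜) := Nat.nth_strictMono hinfinite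
  have hE : ∀ t, constituentEnd 𝒜 (t + 1) = constituentEnd 𝒜 t + constituentLength 𝒜 (t + 1) := by
    intro t
    have := hmono (lt_add_one t)
    simp only [constituentLength]
    omega
  have hgap : ∀ t, IsGap f (constituentEnd 𝒜 t) (constituentLength 𝒜 (t + 1)) := by
    intro t
    have hlt := hmono (lt_add_one t)
    have hEt := hE t
    refine ⟨by omega, ?_, fun s hs0 hs => ?_⟩
    · rw [← hEt]
      exact ((hend _).mp (hmem (t + 1))).2
    · by_contra hne
      have hle := Nat.le_nth_of_lt_nth_succ (p := IsConstituentEnd 𝒜) (k := t)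
        (a := constituentEnd 𝒜 t + s) (by change _ < constituentEnd 𝒜 (t + 1); omega)
        ((hend _).mpr ⟨by have := (hmem t).1; omega, hne⟩)
      change _ ≤ constituentEnd 𝒜 t at hle
      omega
  -- The assumption on two centralizers starts the induction; beyond the first r ends the value 1 is
  -- proved.
  have hone : ∀ t, t < r → f (constituentEnd 𝒜 t) = 1 := fun t ht =>
    (hf01 _ (hmem t).1).2.mpr <|
      (htwo _ (hmem t).1 (hmono.monotone (by omega))).resolve_left (hmem t).2
  have hEt : ∀ t, t + 2 ≤ r → constituentEnd 𝒜 t = (t + 2) * q := by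
    intro t
    induction t with
    | zero => intro; omega
    | succ t ih =>
      intro ht
      rw [hE, ih (by omega), hlq (t + 1) (by omega) ht]
      ring
  have hw : r * q = p ^ (h + k) := by rw [hr, hq, ← pow_add, add_comm]
  have hEw : constituentEnd 𝒜 (r - 2) = r * q := by
    rw [hEt _ (by omega), Nat.sub_add_cancel (by omega)]
  have hgw := hgap (r - 2)
  have hEr := hE (r - 2)
  have honer := hone (r - 1) (by omega)
  rw [show r - 2 + 1 = r - 1 by omega, hEw, hlr] at hgw hEr
  have B : IsBlockSequence q (r * q) (p ^ β) f := by
    refine ⟨S, hEw ▸ hone (r - 2) (by omega), fun i hi hi' => ?_, fun i hi => ?_⟩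
    · rw [show i = r * q + (i - r * q) by omega]
      exact hgw.eq_zero _ (by omega) (by omega)
    · rw [show i = constituentEnd 𝒜 (r - 1) by omega]
      exact honer
  have hlen := B.lengths hp3 hw rfl hr3 hr0 hq rfl hβ hE0 hE hgap hlq (by omega) hone
  -- Blocks have r - 1 terms, so the last of the r prescribed terms, 2q - p^β, opens the second
  -- block.
  refine ⟨?_, hinfinite, isConcatenationOf_of_blocks (M := r - 1) (by omega) fun n => ?_⟩
  · rw [show twoStepCentralizer 𝒜 '' {i | 2 ≤ i}
        = {twoStepCentralizer 𝒜 2, twoStepCentralizer 𝒜 (2 * q)} from ?_,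
      Set.ncard_pair hend0.2.symm]
    refine Set.Subset.antisymm ?_ ?_
    · rintro _ ⟨i, hi, rfl⟩
      by_cases h2 : twoStepCentralizer 𝒜 i = twoStepCentralizer 𝒜 2
      · exact Or.inl h2
      · obtain ⟨t, rfl⟩ := Nat.subset_range_nth (p := IsConstituentEnd 𝒜) ⟨hi, h2⟩
        exact Or.inr ((hf01 _ hi).2.mp (hlen t).1)
    · rintro _ (rfl | rfl)
      · exact ⟨2, le_refl 2, rfl⟩
      · exact ⟨2 * q, hend0.1, rfl⟩
  · have hrest : (List.range (r - 1)).map (fun v => constituentLength 𝒜 (n * (r - 1) + v))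
        = [constituentLength 𝒜 (n * (r - 1))] ++ List.replicate (r - 2) q := by
      rw [show r - 1 = r - 2 + 1 by omega, List.range_succ_eq_map, List.map_cons, List.map_map,
        List.singleton_append, add_zero, List.cons_inj_right, List.eq_replicate_iff]
      refine ⟨by simp, fun b hb => ?_⟩
      obtain ⟨v, hv, rfl⟩ := List.mem_map.mp hb
      have hv := List.mem_range.mp hv
      change constituentLength 𝒜 (n * (r - 2 + 1) + (v + 1)) = q
      refine (hlen _).2.1 fun hd => ?_
      rw [show r - 1 = r - 2 + 1 by omega] at hd
      have := Nat.le_of_dvd (by omega) ((Nat.dvd_add_right (Dvd.intro_left n rfl)).mp hd)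
      omega
    rw [hrest]
    rcases Nat.eq_zero_or_pos n with rfl | hn
    · rw [zero_mul, hl0]
      exact Or.inl rfl
    · rcases (hlen (n * (r - 1))).2.2 (Nat.mul_pos hn (by omega)) (Dvd.intro_left n rfl) with h1 | h1
      · rw [h1]
        exact Or.inl rfl
      · rw [show constituentLength 𝒜 (n * (r - 1)) = 2 * q - p ^ β by omega]
        exact Or.inr rfl
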